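/- Let $V$ be a finite-dimensional complex vector space, let $H_1,\dots,H_p$ be pairwise distinct linear hyperplanes of $V$ ($p\ge 0$), forming an arrangement $\mathcal A$ (not assumed to be free), and let $l_i$ be a linear form on $V$ with kernel $H_i$. Let $L(\mathcal A)$ be the set of all intersections of subfamilies of $\{H_1,\dots,H_p\}$ (the empty intersection being $V$). For $X\in L(\mathcal A)$ put $J(X)=\{i : X\subset H_i\}$, let $r(X)$ be the codimension of $X$ in $V$, and let $\mathcal A_X$ be the arrangement $\{H_i\}_{i\in J(X)}$ in $V$. An arrangement is called irreducible if it is nonempty and is not isomorphic (by a linear isomorphism of the ambient spaces) to a product of two nonempty arrangements, where the product of an arrangement $\mathcal A_1$ in $V_1$ and an arrangement $\mathcal A_2$ in $V_2$ is the arrangement $\{K\times V_2 : K\in\mathcal A_1\}\cup\{V_1\times K : K\in\mathcal A_2\}$ in $V_1\times V_2$. Let $A_V(\mathbf C)$ be the Weyl algebra of differential operators on $V$ with polynomial coefficients. The Bernstein ideal $\mathcal B(\mathcal A)$ is the ideal of the polynomials $b\in\mathbf C[s_1,\dots,s_p]$ such that $$b(s_1,\dots,s_p)\, l_1^{s_1}\cdots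 l_p^{s_p}\in A_V(\mathbf C)[s_1,\dots,s_p]\; l_1^{s_1+1}\cdots l_p^{s_p+1},$$ where the operators act in the usual way on the free module of rank one over $S(V^*)[s_1,\dots,s_p,\tfrac1{l_1\cdots l_p}]$ generated by the symbol $l_1^{s_1}\cdots l_p^{s_p}$. Then there is an integer $N\ge 0$ such that $$\prod_{\substack{X\in L(\mathcal A)\\ \mathcal A_X\ \text{irreducible}}}\ \prod_{j=0}^{N}\Bigl(\sum_{i\in J(X)} s_i+r(X)+j\Bigr)\in\mathcal B(\mathcal A).$$ -/

import Mathlib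

open scoped TensorProduct

noncomputable section

namespace HyperplaneArrangement

/-! ### Combinatorics of an arrangement of linear hyperplanes

An arrangement in `V` is given by its set of hyperplanes, or by a family `H : ι → Submodule ℂ V`
when the hyperplanes are numbered. -/

section Combinatorics

variable {V : Type*} [AddCommGroup V] [Module ℂ V]

/-- The product of the arrangements `A₁` in `V₁` and `A₂` in `V₂`: the arrangement in `V₁ × V₂`
formed by the `K × V₂` with `K` in `A₁` and the `V₁ × K` with `K` in `A₂`. -/
def prodArrangement {V₁ V₂ : Type*} [AddCommGroup V₁] [Module ℂ V₁] [AddCommGroup V₂] [Module ℂ V₂]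
    (A₁ : Set (Submodule ℂ V₁)) (A₂ : Set (Submodule ℂ V₂)) : Set (Submodule ℂ (V₁ × V₂)) :=
  (fun K : Submodule ℂ V₁ => K.prod ⊤) '' A₁ ∪ (fun K : Submodule ℂ V₂ => Submodule.prod ⊤ K) '' A₂

/-- Two arrangements are isomorphic when a linear isomorphism of the ambient spaces carries the
hyperplanes of the first onto those of the second. -/
def IsoArrangement {V W : Type*} [AddCommGroup V] [Module ℂ V] [AddCommGroup W] [Module ℂ W]
    (A : Set (Submodule ℂ V)) (B : Set (Submodule ℂ W)) : Prop :=
  ∃ e : V ≃ₗ[ℂ] W, (fun K : Submodule ℂ V => K.map (e : V →ₗ[ℂ] W)) '' A = B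

/-- An arrangement is irreducible when it is nonempty and not isomorphic to a product of two
nonempty arrangements. -/
def IrreducibleArrangement.{u} {V : Type u} [AddCommGroup V] [Module ℂ V]
    (A : Set (Submodule ℂ V)) : Prop :=
  A.Nonempty ∧
    ¬ ∃ (V₁ V₂ : Type u) (_ : AddCommGroup V₁) (_ : Module ℂ V₁) (_ : AddCommGroup V₂)
        (_ : Module ℂ V₂) (A₁ : Set (Submodule ℂ V₁)) (A₂ : Set (Submodule ℂ V₂)),
        A₁.Nonempty ∧ A₂.Nonempty ∧ IsoArrangement A (prodArrangement A₁ A₂)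

variable {ι : Type*} [Fintype ι]

open Classical in
/-- The set `L(A)` of all intersections of hyperplanes of the arrangement (the intersection of the
empty family is `V`). -/
def intersections (H : ι → Submodule ℂ V) : Finset (Submodule ℂ V) :=
  Finset.univ.image fun T : Finset ι => ⨅ i ∈ T, H i

open Classical in
/-- `J(X)`, the set of the indices of the hyperplanes containing `X`. -/
def J (H : ι → Submodule ℂ V) (X : Submodule ℂ V) : Finset ι :=
  Finset.univ.filter fun i => X ≤ H i

/-- The arrangement `A_X` of the hyperplanes containing `X`. -/
def localArrangement (H : ι → Submodule ℂ V) (X : Submodule ℂ V) : Set (Submodule ℂ V) :=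
  {K | ∃ i ∈ J H X, H i = K}

/-- The codimension `r(X)`. -/
def codim (X : Submodule ℂ V) : ℕ := Module.finrank ℂ (V ⧸ X)

open Classical in
/-- The set of the `X` in `L(A)` whose arrangement `A_X` is irreducible. -/
def irreducibleIntersections (H : ι → Submodule ℂ V) : Finset (Submodule ℂ V) :=
  (intersections H).filter fun X => IrreducibleArrangement (localArrangement H X)

end Combinatorics

/-! ### The Weyl algebra -/

section Weyl

variable (V : Type*) [AddCommGroup V] [Module ℂ V]

/-- The commutation relations `[∂_v, f] = f(v)`, `[f, g] = 0`, `[∂_v, ∂_w] = 0` between the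
elements `(f, v)` of `V* × V`, where `(f, 0)` stands for multiplication by `f` and `(0, v)` for the
derivation `∂_v`. -/
inductive WeylRel : TensorAlgebra ℂ (Module.Dual ℂ V × V) →
    TensorAlgebra ℂ (Module.Dual ℂ V × V) → Prop
  | comm (a b : Module.Dual ℂ V × V) :
      WeylRel (TensorAlgebra.ι ℂ a * TensorAlgebra.ι ℂ b)
        (TensorAlgebra.ι ℂ b * TensorAlgebra.ι ℂ a + algebraMap ℂ _ (b.1 a.2 - a.1 b.2))

/-- The Weyl algebra `A_V(ℂ)` of the differential operators with polynomial coefficients on `V`,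
by generators and relations. -/
abbrev WeylAlgebra := RingQuot (WeylRel V)

/-- The algebra `A_V(ℂ)[s]`, where `s = (s_i)` are central indeterminates. -/
abbrev WeylAlgebraS (ι : Type*) := MvPolynomial ι ℂ ⊗[ℂ] WeylAlgebra V

end Weyl

/-! ### The module `S[s, 1/L] · ∏ l_i ^ s_i` and the Bernstein ideal -/

section Bernstein

variable {V : Type*} [AddCommGroup V] [Module ℂ V] {ι : Type*} [Fintype ι]

/-- The algebra `S = S(V*)` of polynomial functions on `V`. -/
abbrev PolyFun (V : Type*) [AddCommGroup V] [Module ℂ V] := SymmetricAlgebra ℂ (Module.Dual ℂ V)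

/-- `L = ∏ l_i`, as a polynomial function. -/
def defPoly (l : ι → Module.Dual ℂ V) : PolyFun V :=
  ∏ i, SymmetricAlgebra.ι ℂ (Module.Dual ℂ V) (l i)

/-- The algebra `S[1/L]`. -/
def PolyLoc (l : ι → Module.Dual ℂ V) := Localization.Away (defPoly l)

instance (l : ι → Module.Dual ℂ V) : CommRing (PolyLoc l) :=
  inferInstanceAs (CommRing (Localization.Away (defPoly l)))

instance (l : ι → Module.Dual ℂ V) : Algebra ℂ (PolyLoc l) :=
  inferInstanceAs (Algebra ℂ (Localization.Away (defPoly l)))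

instance (l : ι → Module.Dual ℂ V) : Algebra (PolyFun V) (PolyLoc l) :=
  inferInstanceAs (Algebra (PolyFun V) (Localization.Away (defPoly l)))

instance (l : ι → Module.Dual ℂ V) : IsScalarTower ℂ (PolyFun V) (PolyLoc l) :=
  inferInstanceAs (IsScalarTower ℂ (PolyFun V) (Localization.Away (defPoly l)))

instance (l : ι → Module.Dual ℂ V) : IsLocalization.Away (defPoly l) (PolyLoc l) :=
  inferInstanceAs (IsLocalization.Away (defPoly l) (Localization.Away (defPoly l)))

/-- A linear form as an element of `S[1/L]`. -/
def form (l : ι → Module.Dual ℂ V) : Module.Dual ℂ V →ₗ[ℂ] PolyLoc l :=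
  (IsScalarTower.toAlgHom ℂ (PolyFun V) (PolyLoc l)).toLinearMap ∘ₗ
    SymmetricAlgebra.ι ℂ (Module.Dual ℂ V)

lemma isUnit_form (l : ι → Module.Dual ℂ V) (i : ι) : IsUnit (form l (l i)) := by
  have h : IsUnit (algebraMap (PolyFun V) (PolyLoc l) (defPoly l)) :=
    IsLocalization.Away.algebraMap_isUnit _
  have h' : algebraMap (PolyFun V) (PolyLoc l) (defPoly l) = ∏ i, form l (l i) :=
    map_prod (algebraMap (PolyFun V) (PolyLoc l)) _ _
  rw [h'] at h
  exact isUnit_of_dvd_unit (Finset.dvd_prod_of_mem (fun i => form l (l i)) (Finset.mem_univ i)) h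

/-- Two derivations of `S[1/L]` which agree on the linear forms are equal. -/
lemma derivation_ext {l : ι → Module.Dual ℂ V} {D E : Derivation ℂ (PolyLoc l) (PolyLoc l)}
    (h : ∀ f, D (form l f) = E (form l f)) : D = E := by
  have hS : ∀ x : PolyFun V, D (algebraMap _ _ x) = E (algebraMap _ _ x) := by
    intro x
    induction x using SymmetricAlgebra.induction with
    | algebraMap r =>
      rw [← IsScalarTower.algebraMap_apply ℂ (PolyFun V) (PolyLoc l)]; simp
    | ι x => exact h x
    | mul a b ha hb => simp only [map_mul, Derivation.leibniz, ha, hb]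
    | add a b ha hb => simp only [map_add, ha, hb]
  ext x
  obtain ⟨a, b, rfl⟩ := IsLocalization.exists_mk'_eq (Submonoid.powers (defPoly l)) x
  set x := IsLocalization.mk' (PolyLoc l) a b
  have hu : IsUnit (algebraMap (PolyFun V) (PolyLoc l) b) := IsLocalization.map_units _ b
  have hx : x * algebraMap (PolyFun V) (PolyLoc l) b = algebraMap _ _ a :=
    IsLocalization.mk'_spec _ a b
  have h1 := hS a
  rw [← hx, Derivation.leibniz, Derivation.leibniz, hS b] at h1
  exact hu.mul_left_cancel (by simpa using h1)

/-- The algebra morphism `a ↦ a + ε ∂_v(a)` on `S`. -/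
def taylorS (l : ι → Module.Dual ℂ V) (v : V) : PolyFun V →ₐ[ℂ] TrivSqZeroExt (PolyLoc l) (PolyLoc l) :=
  SymmetricAlgebra.lift
    ((TrivSqZeroExt.inlAlgHom ℂ (PolyLoc l) (PolyLoc l)).toLinearMap ∘ₗ form l +
      (TrivSqZeroExt.inrHom (PolyLoc l) (PolyLoc l)).restrictScalars ℂ ∘ₗ
        Algebra.linearMap ℂ (PolyLoc l) ∘ₗ Module.Dual.eval ℂ V v)

lemma fst_taylorS (l : ι → Module.Dual ℂ V) (v : V) (x : PolyFun V) :
    (taylorS l v x).fst = algebraMap _ (PolyLoc l) x := by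
  have : (TrivSqZeroExt.fstHom ℂ (PolyLoc l) (PolyLoc l)).comp (taylorS l v) =
      IsScalarTower.toAlgHom ℂ (PolyFun V) (PolyLoc l) := by
    apply SymmetricAlgebra.algHom_ext
    ext f
    simp [taylorS, form]
  exact DFunLike.congr_fun this x

lemma isUnit_taylorS (l : ι → Module.Dual ℂ V) (v : V) (y : Submonoid.powers (defPoly l)) :
    IsUnit (taylorS l v y) := by
  rw [TrivSqZeroExt.isUnit_iff_isUnit_fst, fst_taylorS]
  exact IsLocalization.map_units _ y

/-- The algebra morphism `a ↦ a + ε ∂_v(a)` on `S[1/L]`. -/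
def taylor (l : ι → Module.Dual ℂ V) (v : V) :
    PolyLoc l →ₐ[ℂ] TrivSqZeroExt (PolyLoc l) (PolyLoc l) :=
  IsLocalization.liftAlgHom (M := Submonoid.powers (defPoly l)) (f := taylorS l v)
    (isUnit_taylorS l v)

lemma taylor_algebraMap (l : ι → Module.Dual ℂ V) (v : V) (x : PolyFun V) :
    taylor l v (algebraMap _ _ x) = taylorS l v x := by
  simp [taylor]

lemma fst_taylor (l : ι → Module.Dual ℂ V) (v : V) (x : PolyLoc l) : (taylor l v x).fst = x := by
  have : (TrivSqZeroExt.fstHom ℂ (PolyLoc l) (PolyLoc l)).comp (taylor l v) =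
      AlgHom.id ℂ (PolyLoc l) := by
    apply IsLocalization.algHom_ext (Submonoid.powers (defPoly l))
    refine AlgHom.ext fun x => ?_
    change (taylor l v (algebraMap _ _ x)).fst = algebraMap _ _ x
    rw [taylor_algebraMap, fst_taylorS]
  exact DFunLike.congr_fun this x

/-- The derivation `∂_v` of `S[1/L]`, for `v` in `V`. -/
def dir (l : ι → Module.Dual ℂ V) (v : V) : Derivation ℂ (PolyLoc l) (PolyLoc l) :=
  Derivation.mk' ((TrivSqZeroExt.sndHom (PolyLoc l) (PolyLoc l)).restrictScalars ℂ ∘ₗ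
      (taylor l v).toLinearMap) <| by
    intro a b
    simp [fst_taylor, mul_comm]

/-- `∂_v(f) = f(v)` for a linear form `f`; this characterizes the derivation `∂_v`. -/
lemma dir_form (l : ι → Module.Dual ℂ V) (v : V) (f : Module.Dual ℂ V) :
    dir l v (form l f) = algebraMap ℂ _ (f v) := by
  change (taylor l v (algebraMap _ _ (SymmetricAlgebra.ι ℂ _ f))).snd = _
  rw [taylor_algebraMap]
  simp [taylorS, Algebra.algebraMap_eq_smul_one]

lemma dir_add (l : ι → Module.Dual ℂ V) (v w : V) : dir l (v + w) = dir l v + dir l w :=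
  derivation_ext fun f => by simp [dir_form]

lemma dir_smul (l : ι → Module.Dual ℂ V) (c : ℂ) (v : V) : dir l (c • v) = c • dir l v :=
  derivation_ext fun f => by simp [dir_form, Algebra.smul_def]

lemma dir_comm (l : ι → Module.Dual ℂ V) (v w : V) (x : PolyLoc l) :
    dir l v (dir l w x) = dir l w (dir l v x) := by
  have : ⁅dir l v, dir l w⁆ = 0 := derivation_ext fun f => by
    simp [Derivation.commutator_apply, dir_form]
  have h := DFunLike.congr_fun this x
  rw [Derivation.commutator_apply] at h
  exact sub_eq_zero.1 h

lemma dir_logDeriv_term (l : ι → Module.Dual ℂ V) (v w : V) (i : ι) :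
    dir l v (dir l w (form l (l i)) * Ring.inverse (form l (l i))) =
      dir l w (dir l v (form l (l i)) * Ring.inverse (form l (l i))) := by
  simp only [dir_form, Derivation.leibniz, Derivation.map_algebraMap, smul_zero, add_zero]
  have key : ∀ z, dir l z (Ring.inverse (form l (l i))) =
      - (algebraMap ℂ _ (l i z)) * Ring.inverse (form l (l i)) ^ 2 := by
    intro z
    have h1 : form l (l i) * Ring.inverse (form l (l i)) = 1 :=
      Ring.mul_inverse_cancel _ (isUnit_form l i)
    have h2 := congrArg (dir l z) h1
    rw [Derivation.leibniz, dir_form, Derivation.map_one_eq_zero, smul_eq_mul, smul_eq_mul] at h2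
    linear_combination Ring.inverse (form l (l i)) * h2 -
      dir l z (Ring.inverse (form l (l i))) * h1
  rw [key, key]
  simp only [smul_eq_mul]
  ring

/-- The space `S[s, 1/L] = ℂ[s] ⊗ S[1/L]`. The element `g` stands for the element
`g · ∏ l_i ^ s_i` of the free module of rank one generated by the symbol `∏ l_i ^ s_i`. -/
def PowModule (l : ι → Module.Dual ℂ V) := MvPolynomial ι ℂ ⊗[ℂ] PolyLoc l

instance (l : ι → Module.Dual ℂ V) : CommRing (PowModule l) :=
  inferInstanceAs (CommRing (MvPolynomial ι ℂ ⊗[ℂ] PolyLoc l))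

instance (l : ι → Module.Dual ℂ V) : Algebra (MvPolynomial ι ℂ) (PowModule l) :=
  inferInstanceAs (Algebra (MvPolynomial ι ℂ) (MvPolynomial ι ℂ ⊗[ℂ] PolyLoc l))

instance (l : ι → Module.Dual ℂ V) : Algebra ℂ (PowModule l) :=
  inferInstanceAs (Algebra ℂ (MvPolynomial ι ℂ ⊗[ℂ] PolyLoc l))

instance (l : ι → Module.Dual ℂ V) : IsScalarTower ℂ (MvPolynomial ι ℂ) (PowModule l) :=
  TensorProduct.isScalarTower_left (R := ℂ) (M := MvPolynomial ι ℂ) (N := PolyLoc l)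

/-- The inclusion of `S[1/L]` in `S[s, 1/L]`. -/
def ofLoc (l : ι → Module.Dual ℂ V) : PolyLoc l →ₐ[ℂ] PowModule l :=
  Algebra.TensorProduct.includeRight (R := ℂ) (A := MvPolynomial ι ℂ) (B := PolyLoc l)

lemma smul_ofLoc (l : ι → Module.Dual ℂ V) (p : MvPolynomial ι ℂ) (a : PolyLoc l) :
    p • ofLoc l a = (p ⊗ₜ[ℂ] a : MvPolynomial ι ℂ ⊗[ℂ] PolyLoc l) := by
  change p • ((1 : MvPolynomial ι ℂ) ⊗ₜ[ℂ] a) = _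
  rw [TensorProduct.smul_tmul', smul_eq_mul, mul_one]

lemma PowModule.induction {l : ι → Module.Dual ℂ V} {motive : PowModule l → Prop}
    (zero : motive 0) (smul : ∀ (p : MvPolynomial ι ℂ) (a : PolyLoc l), motive (p • ofLoc l a))
    (add : ∀ x y, motive x → motive y → motive (x + y)) (x : PowModule l) : motive x :=
  TensorProduct.induction_on (motive := motive) x zero
    (fun p a => smul_ofLoc l p a ▸ smul p a) add

/-- The `ℂ[s]`-linear extension of the derivation `∂_v` to `S[s, 1/L]`. -/
def dirS (l : ι → Module.Dual ℂ V) (v : V) : Module.End (MvPolynomial ι ℂ) (PowModule l) :=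
  (dir l v : PolyLoc l →ₗ[ℂ] PolyLoc l).baseChange (MvPolynomial ι ℂ)

lemma dirS_ofLoc (l : ι → Module.Dual ℂ V) (v : V) (a : PolyLoc l) :
    dirS l v (ofLoc l a) = ofLoc l (dir l v a) :=
  LinearMap.baseChange_tmul (A := MvPolynomial ι ℂ) (f := (dir l v : PolyLoc l →ₗ[ℂ] PolyLoc l)) 1 a

/-- `∑ s_i ∂_v(l_i) / l_i`, the logarithmic derivative along `v` of `∏ l_i ^ s_i`. -/
def logDeriv (l : ι → Module.Dual ℂ V) (v : V) : PowModule l :=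
  ∑ i, (MvPolynomial.X i : MvPolynomial ι ℂ) •
    ofLoc l (dir l v (form l (l i)) * Ring.inverse (form l (l i)))

/-- The action of `∂_v` on `S[s, 1/L] · ∏ l_i ^ s_i`:
`∂_v(g · ∏ l_i ^ s_i) = (∂_v(g) + g · ∑ s_i ∂_v(l_i) / l_i) · ∏ l_i ^ s_i`. -/
def nabla (l : ι → Module.Dual ℂ V) (v : V) : Module.End (MvPolynomial ι ℂ) (PowModule l) :=
  dirS l v + LinearMap.mulLeft (MvPolynomial ι ℂ) (logDeriv l v)

lemma nabla_apply (l : ι → Module.Dual ℂ V) (v : V) (x : PowModule l) :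
    nabla l v x = dirS l v x + logDeriv l v * x := rfl

lemma dirS_mul (l : ι → Module.Dual ℂ V) (v : V) (x y : PowModule l) :
    dirS l v (x * y) = x * dirS l v y + y * dirS l v x := by
  induction x using PowModule.induction with
  | zero => simp
  | add x₁ x₂ h₁ h₂ => rw [add_mul, map_add, h₁, h₂, map_add]; ring
  | smul p a =>
    induction y using PowModule.induction with
    | zero => simp
    | add y₁ y₂ h₁ h₂ => rw [mul_add, map_add, h₁, h₂, map_add]; ring
    | smul q b =>
      simp only [smul_mul_smul_comm, ← map_mul, map_smul, dirS_ofLoc, Derivation.leibniz,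
        smul_eq_mul, map_add, smul_add, mul_comm q p]

lemma dirS_comm (l : ι → Module.Dual ℂ V) (v w : V) (x : PowModule l) :
    dirS l v (dirS l w x) = dirS l w (dirS l v x) := by
  induction x using PowModule.induction with
  | zero => simp
  | add x₁ x₂ h₁ h₂ => simp only [map_add, h₁, h₂]
  | smul p a => simp only [map_smul, dirS_ofLoc, dir_comm l v w]

lemma dirS_add (l : ι → Module.Dual ℂ V) (v w : V) (x : PowModule l) :
    dirS l (v + w) x = dirS l v x + dirS l w x := by
  induction x using PowModule.induction with
  | zero => simp
  | add x₁ x₂ h₁ h₂ => simp only [map_add, h₁, h₂]; abel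
  | smul p a => simp only [map_smul, dirS_ofLoc, dir_add, Derivation.add_apply, map_add, smul_add]

lemma dirS_smul (l : ι → Module.Dual ℂ V) (c : ℂ) (v : V) (x : PowModule l) :
    dirS l (c • v) x = c • dirS l v x := by
  induction x using PowModule.induction with
  | zero => simp
  | add x₁ x₂ h₁ h₂ => simp only [map_add, h₁, h₂, smul_add]
  | smul p a =>
    simp only [map_smul, dirS_ofLoc, dir_smul, Derivation.smul_apply]
    exact smul_comm p c _

lemma logDeriv_add (l : ι → Module.Dual ℂ V) (v w : V) :
    logDeriv l (v + w) = logDeriv l v + logDeriv l w := by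
  simp only [logDeriv, dir_add, Derivation.add_apply, add_mul, map_add, smul_add,
    Finset.sum_add_distrib]

lemma logDeriv_smul (l : ι → Module.Dual ℂ V) (c : ℂ) (v : V) :
    logDeriv l (c • v) = c • logDeriv l v := by
  simp only [logDeriv, dir_smul, Derivation.smul_apply, smul_mul_assoc, map_smul, Finset.smul_sum]
  exact Finset.sum_congr rfl fun i _ => smul_comm _ c _

lemma dirS_logDeriv (l : ι → Module.Dual ℂ V) (v w : V) :
    dirS l v (logDeriv l w) = dirS l w (logDeriv l v) := by
  simp only [logDeriv, map_sum, map_smul, dirS_ofLoc]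
  exact Finset.sum_congr rfl fun i _ => by rw [dir_logDeriv_term]

lemma nabla_comm (l : ι → Module.Dual ℂ V) (v w : V) (x : PowModule l) :
    nabla l v (nabla l w x) = nabla l w (nabla l v x) := by
  simp only [nabla_apply, map_add, dirS_mul, dirS_logDeriv l v w, dirS_comm l v w]
  ring

/-- The action on `S[s, 1/L] · ∏ l_i ^ s_i` of the generators of the Weyl algebra: `(f, v)` acts as
multiplication by `f` plus `∂_v`. -/
def genAction (l : ι → Module.Dual ℂ V) :
    Module.Dual ℂ V × V →ₗ[ℂ] Module.End (MvPolynomial ι ℂ) (PowModule l) where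
  toFun a := LinearMap.mulLeft (MvPolynomial ι ℂ) (ofLoc l (form l a.1)) + nabla l a.2
  map_add' a b := by
    refine LinearMap.ext fun x => ?_
    simp only [Prod.fst_add, Prod.snd_add, map_add, nabla_apply, dirS_add, logDeriv_add,
      LinearMap.add_apply, LinearMap.mulLeft_apply, add_mul]
    abel
  map_smul' c a := by
    refine LinearMap.ext fun x => ?_
    simp only [Prod.smul_fst, Prod.smul_snd, map_smul, nabla_apply, dirS_smul, logDeriv_smul,
      LinearMap.add_apply, LinearMap.smul_apply, LinearMap.mulLeft_apply, smul_mul_assoc, smul_add,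
      RingHom.id_apply]

lemma genAction_apply (l : ι → Module.Dual ℂ V) (a : Module.Dual ℂ V × V) (x : PowModule l) :
    genAction l a x = ofLoc l (form l a.1) * x + nabla l a.2 x := rfl

lemma nabla_form_mul (l : ι → Module.Dual ℂ V) (v : V) (f : Module.Dual ℂ V) (x : PowModule l) :
    nabla l v (ofLoc l (form l f) * x) = ofLoc l (form l f) * nabla l v x + f v • x := by
  simp only [nabla_apply, dirS_mul, dirS_ofLoc, dir_form, AlgHom.commutes, Algebra.smul_def]
  ring

lemma genAction_comm (l : ι → Module.Dual ℂ V) (a b : Module.Dual ℂ V × V) (x : PowModule l) :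
    genAction l a (genAction l b x) =
      genAction l b (genAction l a x) + (b.1 a.2 - a.1 b.2) • x := by
  simp only [genAction_apply, map_add, nabla_form_mul, nabla_comm l a.2 b.2 x, sub_smul,
    mul_left_comm (ofLoc l (form l a.1)) (ofLoc l (form l b.1))]
  abel

/-- The action of the Weyl algebra on `S[s, 1/L] · ∏ l_i ^ s_i`. -/
def weylAction (l : ι → Module.Dual ℂ V) :
    WeylAlgebra V →ₐ[ℂ] Module.End (MvPolynomial ι ℂ) (PowModule l) :=
  RingQuot.liftAlgHom ℂ ⟨TensorAlgebra.lift ℂ (genAction l), by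
    rintro _ _ ⟨a, b⟩
    refine LinearMap.ext fun x => ?_
    simpa [Algebra.algebraMap_eq_smul_one] using genAction_comm l a b x⟩

/-- The action of `A_V(ℂ)[s]` on `S[s, 1/L] · ∏ l_i ^ s_i`. -/
def action (l : ι → Module.Dual ℂ V) :
    WeylAlgebraS V ι →ₐ[MvPolynomial ι ℂ] Module.End (MvPolynomial ι ℂ) (PowModule l) :=
  Algebra.TensorProduct.lift (Algebra.ofId _ _) (weylAction l)
    fun b _ => Algebra.commutes b _

/-- The element `∏ l_i ^ s_i`. -/
def powS (l : ι → Module.Dual ℂ V) : PowModule l := 1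

/-- The element `∏ l_i ^ (s_i + 1) = (∏ l_i) · ∏ l_i ^ s_i`. -/
def powSAddOne (l : ι → Module.Dual ℂ V) : PowModule l :=
  ofLoc l (∏ i, form l (l i))

/-- The Bernstein ideal: the ideal of the polynomials `b` in `ℂ[s]` such that
`b · ∏ l_i ^ s_i` belongs to `A_V(ℂ)[s] · ∏ l_i ^ (s_i + 1)`. -/
def bernsteinIdeal (l : ι → Module.Dual ℂ V) : Ideal (MvPolynomial ι ℂ) where
  carrier := {b | ∃ P : WeylAlgebraS V ι, b • powS l = action l P (powSAddOne l)}
  add_mem' := by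
    rintro b c ⟨P, hP⟩ ⟨Q, hQ⟩
    exact ⟨P + Q, by rw [add_smul, hP, hQ, map_add, LinearMap.add_apply]⟩
  zero_mem' := ⟨0, by simp⟩
  smul_mem' := by
    rintro c b ⟨P, hP⟩
    exact ⟨c • P, by rw [smul_eq_mul, mul_smul, hP, map_smul, LinearMap.smul_apply]⟩

end Bernstein

end HyperplaneArrangement

end

/-! For a set `T` of indices, let the orbit of `T` be what `∏ i ∈ T, l_i` generates under `ℂ[s]`,
the linear forms and the derivations twisted by `∏ i ∈ T, l_i ^ s_i`. A polynomial `b` with `b • 1`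
in this orbit is a Bernstein polynomial of the subarrangement `T`. All orbits are taken inside the
one module `S[s, 1/L]`, so that different `T` can be compared. The theorem is proved by strong
induction on the flats `T`, that is, the sets `J(X)`.

If the arrangement of `T` is a product, coordinates separate and Bernstein polynomials of the
factors multiply (`exists_splitting`, `InOrbit.mul_smul_one`). The irreducible flats below the two
factors are distinct, so no new factor is needed.

If it is irreducible, with centre `Y`, let `b` be a common multiple of the polynomials found for the
proper flats. The polynomial functions `p` with `p * b` in the orbit of `T` form an ideal `I`. Away
from `Y` the arrangement is locally that of a proper flat `T'`: algebraically, `I` contains a power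
of `∏ i ∈ T \ T', l_i` (`InOrbit.exists_prod_pow_mul`). Hence a prime containing `I` contains all
`l_i`, `i ∈ T`, and `I` contains every product of `K` linear forms vanishing on `Y`, for some `K`
(`exists_pow_span_le`). Finally, the Euler operator `∑ ∂_{v_k} f_k` transverse to `Y` multiplies a
product of `j` such forms by `∑ s_i + r(Y) + j`. This lowers the degree from `K` to `0` at the cost
of the factors with `j < K` (`InOrbit.prod_factor_mul`). -/

noncomputable section

namespace HyperplaneArrangement

/-! ### Derivations twisted by the powers of a subfamily of the forms -/

section PartialPowers

variable {V : Type*} [AddCommGroup V] [Module ℂ V] {ι : Type*} [Fintype ι]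

/-- Polynomial functions as elements of `S[s, 1/L]`. -/
def polyMap (l : ι → Module.Dual ℂ V) : PolyFun V →ₐ[ℂ] PowModule l :=
  (ofLoc l).comp (IsScalarTower.toAlgHom ℂ (PolyFun V) (PolyLoc l))

/-- A linear form as an element of `S[s, 1/L]`. -/
def formS (l : ι → Module.Dual ℂ V) : Module.Dual ℂ V →ₗ[ℂ] PowModule l :=
  (ofLoc l).toLinearMap ∘ₗ form l

lemma formS_apply (l : ι → Module.Dual ℂ V) (f : Module.Dual ℂ V) :
    formS l f = ofLoc l (form l f) := rfl

lemma polyMap_ι (l : ι → Module.Dual ℂ V) (f : Module.Dual ℂ V) :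
    polyMap l (SymmetricAlgebra.ι ℂ _ f) = formS l f := rfl

lemma dirS_formS (l : ι → Module.Dual ℂ V) (v : V) (f : Module.Dual ℂ V) :
    dirS l v (formS l f) = algebraMap ℂ _ (f v) := by
  rw [formS_apply, dirS_ofLoc, dir_form, AlgHom.commutes]

lemma dirS_one (l : ι → Module.Dual ℂ V) (v : V) : dirS l v 1 = 0 := by
  rw [← map_one (ofLoc l), dirS_ofLoc]
  simp

lemma dirS_prod_eq_zero (l : ι → Module.Dual ℂ V) (v : V) (T : Finset ι)
    (h : ∀ i ∈ T, l i v = 0) : dirS l v (∏ i ∈ T, formS l (l i)) = 0 := by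
  classical
  induction T using Finset.induction_on with
  | empty => simp [dirS_one]
  | insert i T hi ih =>
    rw [Finset.prod_insert hi, dirS_mul, ih fun j hj => h j (Finset.mem_insert_of_mem hj),
      dirS_formS, h i (Finset.mem_insert_self i T)]
    simp

/-- The inverse of `l_i` in `S[s, 1/L]`. -/
def invS (l : ι → Module.Dual ℂ V) (i : ι) : PowModule l :=
  ofLoc l (Ring.inverse (form l (l i)))

lemma formS_mul_invS (l : ι → Module.Dual ℂ V) (i : ι) : formS l (l i) * invS l i = 1 := by
  rw [formS_apply, invS, ← map_mul, Ring.mul_inverse_cancel _ (isUnit_form l i), map_one]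

/-- The logarithmic derivative along `v` of `∏ i ∈ T, l_i ^ s_i`. -/
def partialLogDeriv (l : ι → Module.Dual ℂ V) (T : Finset ι) (v : V) : PowModule l :=
  ∑ i ∈ T, (MvPolynomial.X i : MvPolynomial ι ℂ) • (algebraMap ℂ _ (l i v) * invS l i)

/-- The conjugate of `∂_v` by `∏ i ∈ T, l_i ^ s_i`. -/
def partialNabla (l : ι → Module.Dual ℂ V) (T : Finset ι) (v : V) :
    Module.End (MvPolynomial ι ℂ) (PowModule l) :=
  dirS l v + LinearMap.mulLeft (MvPolynomial ι ℂ) (partialLogDeriv l T v)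

lemma partialNabla_apply (l : ι → Module.Dual ℂ V) (T : Finset ι) (v : V) (x : PowModule l) :
    partialNabla l T v x = dirS l v x + partialLogDeriv l T v * x := rfl

lemma partialNabla_univ (l : ι → Module.Dual ℂ V) (v : V) :
    partialNabla l Finset.univ v = nabla l v := by
  simp [partialNabla, nabla, partialLogDeriv, logDeriv, dir_form, invS]

lemma partialNabla_mul (l : ι → Module.Dual ℂ V) (T : Finset ι) (v : V) (x y : PowModule l) :
    partialNabla l T v (x * y) = x * partialNabla l T v y + dirS l v x * y := by
  simp only [partialNabla_apply, dirS_mul]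
  ring

lemma partialNabla_formS_mul (l : ι → Module.Dual ℂ V) (T : Finset ι) (v : V)
    (f : Module.Dual ℂ V) (x : PowModule l) :
    partialNabla l T v (formS l f * x) =
      formS l f * partialNabla l T v x + (MvPolynomial.C (f v) : MvPolynomial ι ℂ) • x := by
  rw [partialNabla_mul, dirS_formS, IsScalarTower.algebraMap_apply ℂ (MvPolynomial ι ℂ),
    ← Algebra.smul_def]
  rfl

lemma dirS_invS (l : ι → Module.Dual ℂ V) (v : V) (i : ι) :
    dirS l v (invS l i) = - (algebraMap ℂ _ (l i v)) * invS l i ^ 2 := by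
  have h1 := formS_mul_invS l i
  have h2 := congrArg (dirS l v) h1
  rw [dirS_mul, dirS_formS, dirS_one] at h2
  linear_combination invS l i * h2 - dirS l v (invS l i) * h1

lemma dirS_algebraMap_mul (l : ι → Module.Dual ℂ V) (v : V) (c : ℂ) (x : PowModule l) :
    dirS l v (algebraMap ℂ _ c * x) = algebraMap ℂ _ c * dirS l v x := by
  rw [IsScalarTower.algebraMap_apply ℂ (MvPolynomial ι ℂ), ← Algebra.smul_def, map_smul,
    Algebra.smul_def]

/-- Both sides are `-∑ s_i l_i(v) l_i(w) / l_i ^ 2`, which is symmetric in `v` and `w`. This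
closedness makes the twisted derivations commute. -/
lemma dirS_partialLogDeriv (l : ι → Module.Dual ℂ V) (T : Finset ι) (v w : V) :
    dirS l v (partialLogDeriv l T w) = dirS l w (partialLogDeriv l T v) := by
  simp only [partialLogDeriv, map_sum, map_smul, dirS_algebraMap_mul, dirS_invS]
  exact Finset.sum_congr rfl fun i _ => by congr 1; ring

lemma partialNabla_comm (l : ι → Module.Dual ℂ V) (T : Finset ι) (v w : V) (x : PowModule l) :
    partialNabla l T v (partialNabla l T w x) = partialNabla l T w (partialNabla l T v x) := by
  simp only [partialNabla_apply, map_add, dirS_mul, dirS_partialLogDeriv l T v w, dirS_comm l v w]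
  ring

lemma partialLogDeriv_union [DecidableEq ι] (l : ι → Module.Dual ℂ V) {T₁ T₂ : Finset ι}
    (hT : Disjoint T₁ T₂) (v : V) (h : ∀ i ∈ T₂, l i v = 0) :
    partialLogDeriv l (T₁ ∪ T₂) v = partialLogDeriv l T₁ v := by
  rw [partialLogDeriv, Finset.sum_union hT, partialLogDeriv, add_eq_left]
  exact Finset.sum_eq_zero fun i hi => by simp [h i hi]

/-! ### Orbits: products of arrangements, localization, and the link with the Weyl algebra -/

/-- The elements of `S[s, 1/L]` obtained from `∏ i ∈ T, l_i` by the operators generated over `ℂ[s]`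
by the linear forms and the conjugates by `∏ i ∈ T, l_i ^ s_i` of the `∂_v` for `v` in `W`. -/
inductive InOrbit (l : ι → Module.Dual ℂ V) (T : Finset ι) (W : Submodule ℂ V) :
    PowModule l → Prop
  | base : InOrbit l T W (∏ i ∈ T, formS l (l i))
  | add {x y : PowModule l} : InOrbit l T W x → InOrbit l T W y → InOrbit l T W (x + y)
  | smul (p : MvPolynomial ι ℂ) {x : PowModule l} : InOrbit l T W x → InOrbit l T W (p • x)
  | form_mul (f : Module.Dual ℂ V) {x : PowModule l} :
      InOrbit l T W x → InOrbit l T W (formS l f * x)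
  | nabla {v : V} (hv : v ∈ W) {x : PowModule l} :
      InOrbit l T W x → InOrbit l T W (partialNabla l T v x)

namespace InOrbit

variable {l : ι → Module.Dual ℂ V} {T : Finset ι} {W : Submodule ℂ V}

lemma zero : InOrbit l T W 0 := by
  simpa using smul (0 : MvPolynomial ι ℂ) (base (l := l) (T := T) (W := W))

lemma sub {x y : PowModule l} (hx : InOrbit l T W x) (hy : InOrbit l T W y) :
    InOrbit l T W (x - y) := by
  simpa [sub_eq_add_neg] using hx.add (smul (-1 : MvPolynomial ι ℂ) hy)

lemma sum {κ : Type*} (s : Finset κ) {x : κ → PowModule l} (h : ∀ k ∈ s, InOrbit l T W (x k)) :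
    InOrbit l T W (∑ k ∈ s, x k) := by
  classical
  induction s using Finset.induction_on with
  | empty => simpa using zero
  | insert k s hk ih =>
    rw [Finset.sum_insert hk]
    exact (h k (Finset.mem_insert_self k s)).add
      (ih fun j hj => h j (Finset.mem_insert_of_mem hj))

lemma poly_mul (p : PolyFun V) {x : PowModule l} (hx : InOrbit l T W x) :
    InOrbit l T W (polyMap l p * x) := by
  induction p using SymmetricAlgebra.induction generalizing x with
  | algebraMap c =>
    rw [AlgHom.commutes, IsScalarTower.algebraMap_apply ℂ (MvPolynomial ι ℂ), ← Algebra.smul_def]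
    exact hx.smul _
  | ι f => exact hx.form_mul f
  | mul p q hp hq => rw [map_mul, mul_assoc]; exact hp (hq hx)
  | add p q hp hq => rw [map_add, add_mul]; exact (hp hx).add (hq hx)

/-- Directions along which the `l_i` are constant contribute nothing. -/
lemma of_sup_eq_top {W' : Submodule ℂ V} (hW : W ⊔ W' = ⊤) (h : ∀ i ∈ T, ∀ w ∈ W', l i w = 0)
    {x : PowModule l} (hx : InOrbit l T ⊤ x) : InOrbit l T W x := by
  -- The twisted `∂_w` is here the plain one. It kills the generator `∏ i ∈ T, l_i`, commutes with
  -- the other twisted derivations, and commutes with a form `f` up to the scalar `f w`, so it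
  -- preserves the smaller orbit.
  have key : ∀ w ∈ W', ∀ y, InOrbit l T W y → InOrbit l T W (partialNabla l T w y) := by
    intro w hw y hy
    induction hy with
    | base =>
      have h0 : partialLogDeriv l T w = 0 :=
        Finset.sum_eq_zero fun i hi => by simp [h i hi w hw]
      rw [partialNabla_apply, dirS_prod_eq_zero l w T fun i hi => h i hi w hw, h0]
      simpa using zero
    | add _ _ h₁ h₂ => rw [map_add]; exact h₁.add h₂
    | smul p _ ih => rw [map_smul]; exact ih.smul p
    | form_mul f hy ih => rw [partialNabla_formS_mul]; exact (ih.form_mul f).add (hy.smul _)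
    | nabla hv _ ih => rw [partialNabla_comm]; exact ih.nabla hv
  induction hx with
  | base => exact base
  | add _ _ h₁ h₂ => exact h₁.add h₂
  | smul p _ ih => exact ih.smul p
  | form_mul f _ ih => exact ih.form_mul f
  | @nabla v hv x _ ih =>
    obtain ⟨w, hw, w', hw', rfl⟩ := Submodule.mem_sup.1 (hW.symm ▸ hv : v ∈ W ⊔ W')
    have : partialNabla l T (w + w') x = partialNabla l T w x + partialNabla l T w' x := by
      have hlog : partialLogDeriv l T (w + w') =
          partialLogDeriv l T w + partialLogDeriv l T w' := by
        simp only [partialLogDeriv, map_add, add_mul, smul_add, Finset.sum_add_distrib]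
      simp only [partialNabla_apply, dirS_add, hlog, add_mul]
      abel
    rw [this]
    exact (ih.nabla hw).add (key w' hw' _ ih)

/-- The Bernstein polynomials of two arrangements multiply to one of their product. -/
lemma mul_smul_one [DecidableEq ι] {T₁ T₂ : Finset ι} (hT : Disjoint T₁ T₂) {W₁ W₂ : Submodule ℂ V}
    (hW : W₁ ⊔ W₂ = ⊤) (h₁ : ∀ i ∈ T₁, ∀ w ∈ W₂, l i w = 0) (h₂ : ∀ i ∈ T₂, ∀ w ∈ W₁, l i w = 0)
    {b₁ b₂ : MvPolynomial ι ℂ} (hb₁ : InOrbit l T₁ ⊤ (b₁ • 1)) (hb₂ : InOrbit l T₂ ⊤ (b₂ • 1)) :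
    InOrbit l (T₁ ∪ T₂) ⊤ ((b₁ * b₂) • 1) := by
  -- The forms of `T₂` are constant along `W₁`, so multiplication by their product commutes with the
  -- derivations along `W₁`, and these have the same twist for `T₁` and `T₁ ∪ T₂`.
  have key₁ : ∀ x, InOrbit l T₁ W₁ x →
      InOrbit l (T₁ ∪ T₂) ⊤ ((∏ i ∈ T₂, formS l (l i)) * x) := by
    intro x hx
    induction hx with
    | base => rw [mul_comm, ← Finset.prod_union hT]; exact base
    | add _ _ h₁ h₂ => rw [mul_add]; exact h₁.add h₂
    | smul p _ ih => rw [mul_smul_comm]; exact ih.smul p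
    | form_mul f _ ih => rw [mul_left_comm]; exact ih.form_mul f
    | @nabla v hv x _ ih =>
      have := ih.nabla (v := v) Submodule.mem_top
      rwa [partialNabla_mul, dirS_prod_eq_zero l v T₂ fun i hi => h₂ i hi v hv, zero_mul,
        add_zero, partialNabla_apply, partialLogDeriv_union l hT v fun i hi => h₂ i hi v hv] at this
  -- The operator producing `b₂` from `∏ i ∈ T₂, l_i` is applied to `b₁ • ∏ i ∈ T₂, l_i`, which
  -- `key₁` places in the joint orbit. Directions along `W₂` suffice by `of_sup_eq_top`.
  have key₂ : ∀ x, InOrbit l T₂ W₂ x → InOrbit l (T₁ ∪ T₂) ⊤ (b₁ • x) := by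
    intro x hx
    induction hx with
    | base => simpa using key₁ _ (of_sup_eq_top hW h₁ hb₁)
    | add _ _ h₁ h₂ => rw [smul_add]; exact h₁.add h₂
    | smul p _ ih => rw [smul_comm]; exact ih.smul p
    | form_mul f _ ih => rw [← mul_smul_comm]; exact ih.form_mul f
    | @nabla v hv x _ ih =>
      have := ih.nabla (v := v) Submodule.mem_top
      rwa [map_smul, partialNabla_apply, Finset.union_comm,
        partialLogDeriv_union l hT.symm v fun i hi => h₁ i hi v hv, Finset.union_comm] at this
  rw [mul_smul]
  exact key₂ _ (of_sup_eq_top (sup_comm W₁ W₂ ▸ hW) h₂ hb₂)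

lemma formS_pow_mul_of_le {i : ι} {k n : ℕ} (hkn : k ≤ n) {x : PowModule l}
    (hx : InOrbit l T W (formS l (l i) ^ k * x)) : InOrbit l T W (formS l (l i) ^ n * x) := by
  obtain ⟨m, rfl⟩ := Nat.exists_eq_add_of_le' hkn
  rw [pow_add, mul_assoc, ← polyMap_ι, ← map_pow]
  exact hx.poly_mul _

/-- Localization: a hyperplane can be added at the cost of a denominator. -/
lemma exists_formS_pow_mul [DecidableEq ι] {i : ι} (hi : i ∉ T) {x : PowModule l}
    (hx : InOrbit l T ⊤ x) : ∃ k : ℕ, InOrbit l (insert i T) ⊤ (formS l (l i) ^ k * x) := by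
  induction hx with
  | base =>
    refine ⟨1, ?_⟩
    rw [pow_one, ← Finset.prod_insert (f := fun j => formS l (l j)) hi]
    exact base
  | add _ _ h₁ h₂ =>
    obtain ⟨k, hk⟩ := h₁
    obtain ⟨n, hn⟩ := h₂
    refine ⟨max k n, ?_⟩
    rw [mul_add]
    exact (formS_pow_mul_of_le (le_max_left k n) hk).add (formS_pow_mul_of_le (le_max_right k n) hn)
  | smul p _ ih => obtain ⟨k, hk⟩ := ih; exact ⟨k, by rw [mul_smul_comm]; exact hk.smul p⟩
  | form_mul f _ ih => obtain ⟨k, hk⟩ := ih; exact ⟨k, by rw [mul_left_comm]; exact hk.form_mul f⟩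
  | @nabla v _ x _ ih =>
    obtain ⟨k, hk⟩ := ih
    refine ⟨k + 1, ?_⟩
    have hpow : ∀ n : ℕ, dirS l v (formS l (l i) ^ (n + 1)) =
        algebraMap ℂ _ ((n + 1) * l i v) * formS l (l i) ^ n := by
      intro n
      induction n with
      | zero => simp [dirS_formS]
      | succ n ih =>
        rw [pow_succ, dirS_mul, ih, dirS_formS]
        simp only [map_mul, map_add, map_natCast, map_one, Nat.cast_add, Nat.cast_one]
        ring
    have hlog : partialLogDeriv l (insert i T) v = partialLogDeriv l T v +
        algebraMap (MvPolynomial ι ℂ) _ (MvPolynomial.X i) * algebraMap ℂ _ (l i v) * invS l i := by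
      rw [partialLogDeriv, Finset.sum_insert hi, ← partialLogDeriv, Algebra.smul_def]
      ring
    -- Leibniz rule for `l_i ^ (k + 1) * x`: the new twist contributes `s_i` and the power
    -- contributes `k + 1`, both times `l_i(v) l_i ^ k x`. One extra power of `l_i` absorbs the pole
    -- of the new twist.
    have heq : formS l (l i) ^ (k + 1) * partialNabla l T v x =
        partialNabla l (insert i T) v (formS l (l i) * (formS l (l i) ^ k * x)) -
          (MvPolynomial.C (l i v) * (MvPolynomial.X i + ((k : MvPolynomial ι ℂ) + 1)) : MvPolynomial ι ℂ) • (formS l (l i) ^ k * x) := by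
      have hC : algebraMap (MvPolynomial ι ℂ) (PowModule l) (MvPolynomial.C (l i v)) =
        algebraMap ℂ _ (l i v) := (IsScalarTower.algebraMap_apply ℂ (MvPolynomial ι ℂ) _ _).symm
      rw [← mul_assoc, ← pow_succ', partialNabla_mul, hpow, partialNabla_apply, partialNabla_apply,
        hlog, Algebra.smul_def]
      simp only [map_mul, map_add, map_natCast, map_one, hC]
      linear_combination (-algebraMap (MvPolynomial ι ℂ) (PowModule l) (MvPolynomial.X i) *
        algebraMap ℂ _ (l i v) * formS l (l i) ^ k * x) * formS_mul_invS l i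
    rw [heq]
    exact ((hk.form_mul _).nabla Submodule.mem_top).sub (hk.smul _)

lemma exists_prod_pow_mul [DecidableEq ι] (D : Finset ι) (hD : Disjoint D T) {x : PowModule l}
    (hx : InOrbit l T ⊤ x) :
    ∃ k : ℕ, InOrbit l (D ∪ T) ⊤ ((∏ i ∈ D, formS l (l i)) ^ k * x) := by
  induction D using Finset.induction_on with
  | empty => exact ⟨0, by simpa using hx⟩
  | insert i D hi ih =>
    rw [Finset.disjoint_insert_left] at hD
    obtain ⟨k, hk⟩ := ih hD.2
    obtain ⟨n, hn⟩ := exists_formS_pow_mul (i := i) (by simp [hi, hD.1]) hk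
    refine ⟨n + k, ?_⟩
    -- Multiplying by `l_i ^ k` and `(∏ j ∈ D, l_j) ^ n` raises both exponents to the common value
    -- `n + k`.
    have := (hn.poly_mul
      (SymmetricAlgebra.ι ℂ _ (l i) ^ k * (∏ j ∈ D, SymmetricAlgebra.ι ℂ _ (l j)) ^ n))
    simp only [map_mul, map_pow, map_prod, polyMap_ι] at this
    rw [Finset.insert_union, Finset.prod_insert hi]
    convert this using 1
    ring

end InOrbit

/-- Each constructor of the full orbit is realized by an element of the algebra: `(f, 0)` gives
multiplication by `f`, and `(0, v)` gives `∂_v`, the twist by all of the indices being the original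
one. -/
lemma action_of_inOrbit {l : ι → Module.Dual ℂ V} {x : PowModule l}
    (hx : InOrbit l Finset.univ ⊤ x) : ∃ P : WeylAlgebraS V ι, x = action l P (powSAddOne l) := by
  have hgen : ∀ a : Module.Dual ℂ V × V, ∃ P : WeylAlgebraS V ι, action l P = genAction l a := by
    intro a
    refine ⟨1 ⊗ₜ RingQuot.mkAlgHom ℂ (WeylRel V) (TensorAlgebra.ι ℂ a), ?_⟩
    simp [action, weylAction]
  induction hx with
  | base => exact ⟨1, by simp [powSAddOne, formS_apply]⟩
  | add _ _ h₁ h₂ =>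
    obtain ⟨P, rfl⟩ := h₁
    obtain ⟨Q, rfl⟩ := h₂
    exact ⟨P + Q, by simp⟩
  | smul p _ ih => obtain ⟨P, rfl⟩ := ih; exact ⟨p • P, by simp⟩
  | form_mul f _ ih =>
    obtain ⟨P, rfl⟩ := ih
    obtain ⟨Q, hQ⟩ := hgen (f, 0)
    refine ⟨Q * P, ?_⟩
    have h0 : nabla l (0 : V) = 0 := by
      refine LinearMap.ext fun x => ?_
      have h₁ := dirS_smul l 0 (0 : V) x
      have h₂ := logDeriv_smul l 0 (0 : V)
      rw [zero_smul, zero_smul] at h₁ h₂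
      simp [nabla_apply, h₁, h₂]
    rw [map_mul, hQ, Module.End.mul_apply, genAction_apply, h0]
    simp [formS_apply]
  | @nabla v _ x _ ih =>
    obtain ⟨P, rfl⟩ := ih
    obtain ⟨Q, hQ⟩ := hgen (0, v)
    refine ⟨Q * P, ?_⟩
    rw [map_mul, hQ, Module.End.mul_apply, genAction_apply, partialNabla_univ]
    simp

end PartialPowers

/-! ### The Euler operator transverse to a flat -/

section EulerOperator

variable {V : Type*} [AddCommGroup V] [Module ℂ V] {ι : Type*} [Fintype ι]

/-- The factor `∑ i ∈ T, s_i + r(Y) + j`. -/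
def factor (T : Finset ι) (Y : Submodule ℂ V) (j : ℕ) : MvPolynomial ι ℂ :=
  ∑ i ∈ T, MvPolynomial.X i + MvPolynomial.C ((codim Y : ℂ) + (j : ℂ))

/-- A dual pair of families of linear forms vanishing on `Y` and of vectors. -/
lemma exists_dual_family [FiniteDimensional ℂ V] (Y : Submodule ℂ V) :
    ∃ (f : Fin (codim Y) → Module.Dual ℂ V) (v : Fin (codim Y) → V),
      (∀ k, f k ∈ Y.dualAnnihilator) ∧ (∀ k, f k (v k) = 1) ∧
        ∀ g ∈ Y.dualAnnihilator, ∑ k, g (v k) • f k = g := by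
  let B : Module.Basis (Fin (codim Y)) ℂ (V ⧸ Y) := Module.finBasis ℂ (V ⧸ Y)
  choose v hv using fun k => Y.mkQ_surjective (B k)
  refine ⟨fun k => B.coord k ∘ₗ Y.mkQ, v, fun k => ?_, fun k => ?_, fun g hg => ?_⟩
  · rw [Submodule.mem_dualAnnihilator]
    intro y hy
    simp [(Submodule.Quotient.mk_eq_zero Y).2 hy]
  · simp [hv]
  · have hgY : Y ≤ LinearMap.ker g := fun y hy => (Submodule.mem_dualAnnihilator g).1 hg y hy
    have hg' : ∀ w, Y.liftQ g hgY (Y.mkQ w) = g w := fun w => rfl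
    refine LinearMap.ext fun w => ?_
    have h := congrArg (Y.liftQ g hgY) (B.sum_repr (Y.mkQ w))
    rw [hg', map_sum] at h
    rw [← h, LinearMap.sum_apply]
    refine Finset.sum_congr rfl fun k _ => ?_
    rw [map_smul, ← hv k, hg']
    simp [mul_comm]

/-- Applying `∑ ∂_{v_k} f_k` to a product of `n` linear forms. -/
lemma sum_partialNabla_formS_mul (l : ι → Module.Dual ℂ V) (T : Finset ι) {Y : Submodule ℂ V}
    {f : Fin (codim Y) → Module.Dual ℂ V} {v : Fin (codim Y) → V} (h1 : ∀ k, f k (v k) = 1)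
    (hsum : ∀ g ∈ Y.dualAnnihilator, ∑ k, g (v k) • f k = g)
    (hT : ∀ i ∈ T, l i ∈ Y.dualAnnihilator) (F : List (Module.Dual ℂ V))
    (hF : ∀ g ∈ F, g ∈ Y.dualAnnihilator) :
    ∑ k, partialNabla l T (v k) (formS l (f k) * (F.map (formS l)).prod) =
      factor T Y F.length • (F.map (formS l)).prod := by
  -- The field `∑ f_k ∂_{v_k}` fixes every form vanishing on `Y`; hence the degree in `hprod`, and
  -- the term `∑ s_i` in `hlog`.
  have hE : ∀ g ∈ Y.dualAnnihilator, ∑ k, formS l (f k) * algebraMap ℂ _ (g (v k)) = formS l g := by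
    intro g hg
    conv_rhs => rw [← hsum g hg, map_sum]
    exact Finset.sum_congr rfl fun k _ => by rw [map_smul, Algebra.smul_def, mul_comm]
  have hprod : ∀ G : List (Module.Dual ℂ V), (∀ g ∈ G, g ∈ Y.dualAnnihilator) →
      ∑ k, formS l (f k) * dirS l (v k) (G.map (formS l)).prod =
        (G.length : PowModule l) * (G.map (formS l)).prod := by
    intro G hG
    induction G with
    | nil => simp [dirS_one]
    | cons g G ih =>
      have ih' := ih fun g' hg' => hG g' (List.mem_cons_of_mem g hg')
      have hg := hE g (hG g List.mem_cons_self)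
      simp only [List.map_cons, List.prod_cons, dirS_mul, dirS_formS, List.length_cons,
        Nat.cast_add, Nat.cast_one, mul_add, Finset.sum_add_distrib]
      have e₁ : ∑ k, formS l (f k) * (formS l g * dirS l (v k) (G.map (formS l)).prod) =
          formS l g * ∑ k, formS l (f k) * dirS l (v k) (G.map (formS l)).prod := by
        rw [Finset.mul_sum]
        exact Finset.sum_congr rfl fun k _ => by ring
      have e₂ : ∑ k, formS l (f k) * ((G.map (formS l)).prod * algebraMap ℂ _ (g (v k))) =
          (G.map (formS l)).prod * ∑ k, formS l (f k) * algebraMap ℂ _ (g (v k)) := by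
        rw [Finset.mul_sum]
        exact Finset.sum_congr rfl fun k _ => by ring
      rw [e₁, e₂, ih', hg]
      ring
  have hlog : ∑ k, formS l (f k) * partialLogDeriv l T (v k) =
      algebraMap (MvPolynomial ι ℂ) _ (∑ i ∈ T, MvPolynomial.X i) := by
    simp only [partialLogDeriv, Finset.mul_sum]
    rw [Finset.sum_comm, map_sum]
    refine Finset.sum_congr rfl fun i hi => ?_
    rw [← mul_one (algebraMap (MvPolynomial ι ℂ) (PowModule l) _), ← formS_mul_invS l i,
      ← hE _ (hT i hi), Finset.sum_mul, Finset.mul_sum]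
    exact Finset.sum_congr rfl fun k _ => by rw [Algebra.smul_def]; ring
  -- The commutator `[∂_{v_k}, f_k] = 1` gives the last summand; summed over `k` it accounts for
  -- `r(Y)`.
  have hterm : ∀ k, partialNabla l T (v k) (formS l (f k) * (F.map (formS l)).prod) =
      formS l (f k) * dirS l (v k) (F.map (formS l)).prod +
        formS l (f k) * partialLogDeriv l T (v k) * (F.map (formS l)).prod +
          (F.map (formS l)).prod := by
    intro k
    rw [partialNabla_formS_mul, h1, partialNabla_apply, map_one, one_smul]
    ring
  simp only [hterm, Finset.sum_add_distrib, ← Finset.sum_mul, hlog, hprod F hF, factor]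
  rw [Algebra.smul_def]
  simp only [Finset.sum_const, Finset.card_univ, Fintype.card_fin, nsmul_eq_mul, map_add,
    map_natCast]
  ring

/-- If the products of `K` linear forms vanishing on `Y` send `b` into the orbit, then so does the
product of the factors `∑ s_i + r(Y) + j` for `j < K`. -/
lemma InOrbit.prod_factor_mul [FiniteDimensional ℂ V] {l : ι → Module.Dual ℂ V} {T : Finset ι}
    {Y : Submodule ℂ V} (hT : ∀ i ∈ T, l i ∈ Y.dualAnnihilator) (K : ℕ) (b : MvPolynomial ι ℂ)
    (h : ∀ F : List (Module.Dual ℂ V), F.length = K → (∀ g ∈ F, g ∈ Y.dualAnnihilator) →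
      InOrbit l T ⊤ (b • (F.map (formS l)).prod)) :
    InOrbit l T ⊤ (((∏ j ∈ Finset.range K, factor T Y j) * b) • 1) := by
  induction K generalizing b with
  | zero => simpa using h [] rfl (by simp)
  | succ K ih =>
    rw [Finset.prod_range_succ, mul_assoc]
    -- For `F` of length `K`, the Euler identity writes `factor T Y K` times the product of `F` as a
    -- sum of derivatives of products of the `K + 1` forms `f_k :: F`, which the hypothesis covers.
    refine ih _ fun F hF hFY => ?_
    obtain ⟨f, v, hf, h1, hsum⟩ := exists_dual_family Y
    rw [mul_comm, mul_smul, ← hF, ← sum_partialNabla_formS_mul l T h1 hsum hT F hFY,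
      Finset.smul_sum]
    refine InOrbit.sum _ fun k _ => ?_
    rw [← map_smul]
    refine InOrbit.nabla Submodule.mem_top ?_
    simpa using h (f k :: F) (by simp [hF]) fun g hg => by
      rcases List.mem_cons.1 hg with rfl | hg
      exacts [hf k, hFY g hg]

end EulerOperator

/-! ### Flats and the ideal of the centre -/

section Flats

/-- The linear forms lying in an ideal make up a linear subspace. For a prime, this is why the
indices of the forms it contains make up a flat. -/
lemma ι_mem_of_mem_span {V : Type*} [AddCommGroup V] [Module ℂ V] {ι : Type*}
    {l : ι → Module.Dual ℂ V} {T : Finset ι} {P : Ideal (PolyFun V)}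
    (hP : ∀ i ∈ T, SymmetricAlgebra.ι ℂ _ (l i) ∈ P) {g : Module.Dual ℂ V}
    (hg : g ∈ Submodule.span ℂ (l '' T)) : SymmetricAlgebra.ι ℂ _ g ∈ P := by
  have : Submodule.span ℂ (l '' T) ≤
      (P.restrictScalars ℂ).comap (SymmetricAlgebra.ι ℂ (Module.Dual ℂ V)) := by
    rw [Submodule.span_le]
    rintro _ ⟨i, hi, rfl⟩
    exact hP i hi
  exact this hg

variable {V : Type*} [AddCommGroup V] [Module ℂ V] {ι : Type*} [Fintype ι]

/-- The set of the hyperplanes numbered by `T` contains all hyperplanes through its intersection. -/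
def IsFlat (H : ι → Submodule ℂ V) (T : Finset ι) : Prop :=
  ∀ j, ⨅ i ∈ T, H i ≤ H j → j ∈ T

lemma J_iInf {H : ι → Submodule ℂ V} {T : Finset ι} (hT : IsFlat H T) :
    J H (⨅ i ∈ T, H i) = T := by
  ext j
  simp only [J, Finset.mem_filter, Finset.mem_univ, true_and]
  exact ⟨hT j, fun hj => iInf₂_le j hj⟩

lemma mem_span_of_iInf_le [FiniteDimensional ℂ V] {l : ι → Module.Dual ℂ V} {T : Finset ι}
    {g : Module.Dual ℂ V} (h : ⨅ i ∈ T, LinearMap.ker (l i) ≤ LinearMap.ker g) :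
    g ∈ Submodule.span ℂ (l '' T) := by
  have := mem_span_of_iInf_ker_le_ker (L := fun i : T => l i) (K := g) (by rwa [iInf_subtype])
  rw [Set.image_eq_range]
  exact this

/-- An ideal which contains, for each flat strictly contained in `T`, a power of the product of the
other forms of `T`, contains a power of the ideal generated by the forms of `T`. -/
lemma exists_pow_span_le [FiniteDimensional ℂ V] [DecidableEq ι] {l : ι → Module.Dual ℂ V}
    {T : Finset ι} (hT : IsFlat (fun i => LinearMap.ker (l i)) T) {I : Ideal (PolyFun V)}
    (hI : ∀ T' ⊂ T, IsFlat (fun i => LinearMap.ker (l i)) T' →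
      ∃ k : ℕ, (∏ i ∈ T \ T', SymmetricAlgebra.ι ℂ _ (l i)) ^ k ∈ I) :
    ∃ K : ℕ, Ideal.span ((fun i => SymmetricAlgebra.ι ℂ _ (l i)) '' (T : Set ι)) ^ K ≤ I := by
  classical
  refine Ideal.exists_pow_le_of_le_radical_of_fg ?_
    (Submodule.fg_span (T.finite_toSet.image _))
  rw [Ideal.radical_eq_sInf, le_sInf_iff]
  rintro P ⟨hIP, hP⟩
  rw [Ideal.span_le]
  rintro _ ⟨i, hi, rfl⟩
  by_contra hiP
  -- Geometrically, `T'` records the hyperplanes of `T` containing the zero set of `P`. If `T'` were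
  -- proper, primality would put in `P` one of the forms of `T \ T'`.
  set T' := T.filter fun j => SymmetricAlgebra.ι ℂ _ (l j) ∈ P with hT'
  have hT'T : T' ⊆ T := Finset.filter_subset _ _
  have hflat : IsFlat (fun i => LinearMap.ker (l i)) T' := by
    intro j hj
    rw [hT', Finset.mem_filter]
    exact ⟨hT j ((biInf_mono fun i hi => hT'T hi).trans hj),
      ι_mem_of_mem_span (fun i hi => (Finset.mem_filter.1 hi).2) (mem_span_of_iInf_le hj)⟩
  have hne : T' ⊂ T := ⟨hT'T, fun h => hiP (Finset.mem_filter.1 (h hi)).2⟩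
  obtain ⟨k, hk⟩ := hI T' hne hflat
  have := hP.mem_of_pow_mem k (hIP hk)
  rw [hP.prod_mem_iff] at this
  obtain ⟨j, hj, hjP⟩ := this
  rw [Finset.mem_sdiff] at hj
  exact hj.2 (Finset.mem_filter.2 ⟨hj.1, hjP⟩)

/-- By duality, a form vanishing on the intersection is a combination of the `l_i`, `i ∈ T`, so each
factor lies in the ideal they generate. -/
lemma list_prod_ι_mem_pow_span [FiniteDimensional ℂ V] {l : ι → Module.Dual ℂ V} {T : Finset ι}
    (G : List (Module.Dual ℂ V))
    (hG : ∀ g ∈ G, g ∈ (⨅ i ∈ T, LinearMap.ker (l i)).dualAnnihilator) :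
    (G.map (SymmetricAlgebra.ι ℂ (Module.Dual ℂ V))).prod ∈
      Ideal.span ((fun i => SymmetricAlgebra.ι ℂ _ (l i)) '' (T : Set ι)) ^ G.length := by
  induction G with
  | nil => simp
  | cons g G ih =>
    have hker : (⨅ i ∈ T, LinearMap.ker (l i)) ≤ LinearMap.ker g := fun y hy =>
      (Submodule.mem_dualAnnihilator g).1 (hG g List.mem_cons_self) y hy
    have hgen : ∀ i ∈ T, SymmetricAlgebra.ι ℂ _ (l i) ∈
        Ideal.span ((fun i => SymmetricAlgebra.ι ℂ _ (l i)) '' (T : Set ι)) := fun i hi =>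
      Ideal.subset_span (Set.mem_image_of_mem (fun i => SymmetricAlgebra.ι ℂ _ (l i)) hi)
    have hgP := ι_mem_of_mem_span hgen (mem_span_of_iInf_le hker)
    rw [List.map_cons, List.prod_cons, List.length_cons, pow_succ']
    exact Ideal.mul_mem_mul hgP (ih fun g' hg' => hG g' (List.mem_cons_of_mem g hg'))

/-- From the proper flats of `T` to `T`. -/
lemma InOrbit.exists_of_proper_flats [FiniteDimensional ℂ V] {l : ι → Module.Dual ℂ V}
    {T : Finset ι} (hT : IsFlat (fun i => LinearMap.ker (l i)) T) {b : MvPolynomial ι ℂ}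
    (h : ∀ T' ⊂ T, IsFlat (fun i => LinearMap.ker (l i)) T' → InOrbit l T' ⊤ (b • 1)) :
    ∃ K : ℕ, InOrbit l T ⊤
      (((∏ j ∈ Finset.range K, factor T (⨅ i ∈ T, LinearMap.ker (l i)) j) * b) • 1) := by
  classical
  -- The multipliers that carry `b` into the orbit; stability under `S` is `InOrbit.poly_mul`.
  let I : Ideal (PolyFun V) :=
    { carrier := {p | InOrbit l T ⊤ (polyMap l p * (b • 1))}
      add_mem' := by
        intro p q hp hq
        change InOrbit l T ⊤ (polyMap l (p + q) * _)
        rw [map_add, add_mul]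
        exact hp.add hq
      zero_mem' := by
        change InOrbit l T ⊤ (polyMap l 0 * _)
        rw [map_zero, zero_mul]
        exact InOrbit.zero
      smul_mem' := by
        intro p q hq
        change InOrbit l T ⊤ (polyMap l (p * q) * _)
        rw [map_mul, mul_assoc]
        exact hq.poly_mul p }
  obtain ⟨K, hK⟩ := exists_pow_span_le hT (I := I) <| by
    intro T' hT' hflat
    obtain ⟨k, hk⟩ := (h T' hT' hflat).exists_prod_pow_mul (T \ T') Finset.sdiff_disjoint
    refine ⟨k, ?_⟩
    change InOrbit l T ⊤ (polyMap l _ * _)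
    rw [Finset.sdiff_union_of_subset hT'.1] at hk
    simpa only [map_pow, map_prod, polyMap_ι] using hk
  refine ⟨K, InOrbit.prod_factor_mul (fun i hi => ?_) K b fun F hF hFY => ?_⟩
  · rw [Submodule.mem_dualAnnihilator]
    exact fun y hy => (iInf₂_le i hi : (⨅ i ∈ T, LinearMap.ker (l i)) ≤ LinearMap.ker (l i)) hy
  · have hmem := list_prod_ι_mem_pow_span F hFY
    have : InOrbit l T ⊤ (polyMap l _ * (b • 1)) := hK (by rwa [hF] at hmem)
    rwa [map_list_prod, List.map_map, mul_smul_comm, mul_one] at this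

/-! ### Splitting of reducible flats -/

lemma comap_le_of_le_map {V W : Type*} [AddCommGroup V] [Module ℂ V] [AddCommGroup W] [Module ℂ W]
    (e : V ≃ₗ[ℂ] W) {L : Submodule ℂ V} {K : Submodule ℂ W} (h : K ≤ L.map (e : V →ₗ[ℂ] W)) :
    K.comap (e : V →ₗ[ℂ] W) ≤ L := by
  rw [← Submodule.comap_map_eq_of_injective (f := (e : V →ₗ[ℂ] W)) e.injective L]
  exact Submodule.comap_mono h

/-- A nonempty arrangement `A_Y` which is not irreducible splits along a decomposition of the
ambient space. -/
lemma exists_splitting {H : ι → Submodule ℂ V} (hH : ∀ i, H i ≠ ⊤) {T : Finset ι}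
    (hT : IsFlat H T) (hne : T.Nonempty)
    (hirr : ¬ IrreducibleArrangement (localArrangement H (⨅ i ∈ T, H i))) :
    ∃ (T₁ T₂ : Finset ι) (W₁ W₂ : Submodule ℂ V), T₁ ⊂ T ∧ T₂ ⊂ T ∧ Disjoint T₁ T₂ ∧
      (∀ i ∈ T, i ∈ T₁ ∨ i ∈ T₂) ∧ IsFlat H T₁ ∧ IsFlat H T₂ ∧ W₁ ⊔ W₂ = ⊤ ∧
      (∀ i ∈ T₁, W₂ ≤ H i) ∧ ∀ i ∈ T₂, W₁ ≤ H i := by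
  classical
  have hJ := J_iInf hT
  have hA : (localArrangement H (⨅ i ∈ T, H i)).Nonempty := by
    obtain ⟨i, hi⟩ := hne
    exact ⟨H i, i, hJ.symm ▸ hi, rfl⟩
  unfold IrreducibleArrangement at hirr
  rw [not_and, not_not] at hirr
  obtain ⟨V₁, V₂, _, _, _, _, A₁, A₂, ⟨K₁, hK₁⟩, ⟨K₂, hK₂⟩, e, he⟩ := hirr hA
  -- `W₁` and `W₂` are the copies in `V` of `V₁ × 0` and `0 × V₂`. A hyperplane `K × V₂` contains `0
  -- × V₂`, so `T₁` will consist of the indices with `W₂ ≤ H i`, and `T₂` of those with `W₁ ≤ H i`.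
  set W₁ : Submodule ℂ V := (Submodule.prod ⊤ ⊥).comap (e : V →ₗ[ℂ] V₁ × V₂) with hW₁
  set W₂ : Submodule ℂ V := (Submodule.prod ⊥ ⊤).comap (e : V →ₗ[ℂ] V₁ × V₂) with hW₂
  have hsup : W₁ ⊔ W₂ = ⊤ := by
    rw [eq_top_iff]
    intro v _
    refine Submodule.mem_sup.2 ⟨e.symm ((e v).1, 0), ?_, e.symm (0, (e v).2), ?_, ?_⟩
    · simp [hW₁]
    · simp [hW₂]
    · rw [← map_add]; simp
  have hor : ∀ i ∈ T, W₂ ≤ H i ∨ W₁ ≤ H i := by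
    intro i hi
    have : (H i).map (e : V →ₗ[ℂ] V₁ × V₂) ∈ prodArrangement A₁ A₂ :=
      he ▸ ⟨H i, ⟨i, hJ.symm ▸ hi, rfl⟩, rfl⟩
    rcases this with ⟨K, -, hK⟩ | ⟨K, -, hK⟩
    · exact Or.inl (comap_le_of_le_map e (hK ▸ Submodule.prod_mono bot_le le_rfl))
    · exact Or.inr (comap_le_of_le_map e (hK ▸ Submodule.prod_mono le_rfl bot_le))
  have hnot : ∀ i, W₂ ≤ H i → ¬ W₁ ≤ H i := fun i h₂ h₁ =>
    hH i (top_le_iff.1 (hsup ▸ sup_le h₁ h₂))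
  obtain ⟨i₁, hi₁, hi₁W⟩ : ∃ i ∈ T, W₂ ≤ H i := by
    have : (K₁.prod ⊤ : Submodule ℂ (V₁ × V₂)) ∈ prodArrangement A₁ A₂ := Or.inl ⟨K₁, hK₁, rfl⟩
    rw [← he] at this
    obtain ⟨_, ⟨i, hi, rfl⟩, hiK⟩ := this
    exact ⟨i, hJ ▸ hi, comap_le_of_le_map e
      ((Submodule.prod_mono bot_le le_rfl).trans (le_of_eq hiK.symm))⟩
  obtain ⟨i₂, hi₂, hi₂W⟩ : ∃ i ∈ T, W₁ ≤ H i := by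
    have : (Submodule.prod ⊤ K₂ : Submodule ℂ (V₁ × V₂)) ∈ prodArrangement A₁ A₂ :=
      Or.inr ⟨K₂, hK₂, rfl⟩
    rw [← he] at this
    obtain ⟨_, ⟨i, hi, rfl⟩, hiK⟩ := this
    exact ⟨i, hJ ▸ hi, comap_le_of_le_map e
      ((Submodule.prod_mono le_rfl bot_le).trans (le_of_eq hiK.symm))⟩
  obtain ⟨S, hS⟩ : ∃ S : Submodule ℂ V → Finset ι, ∀ W i, i ∈ S W ↔ i ∈ T ∧ W ≤ H i :=
    ⟨fun W => T.filter fun i => W ≤ H i, fun W i => Finset.mem_filter⟩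
  have hST : ∀ W, S W ⊆ T := fun W i hi => ((hS W i).1 hi).1
  have hSW : ∀ W, ∀ i ∈ S W, W ≤ H i := fun W i hi => ((hS W i).1 hi).2
  -- If `H j` contains the intersection of the `H i`, `i ∈ S W`, it contains that of all of `T`, so
  -- `j ∈ T`, and it contains `W`, which lies in each of those `H i`.
  have hflat : ∀ W, IsFlat H (S W) := fun W j hj => (hS W j).2
    ⟨hT j ((biInf_mono fun i hi => hST W hi).trans hj), (le_iInf₂ (hSW W)).trans hj⟩
  refine ⟨S W₂, S W₁, W₁, W₂, ⟨hST W₂, fun h => hnot i₂ (hSW W₂ i₂ (h hi₂)) hi₂W⟩,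
    ⟨hST W₁, fun h => hnot i₁ hi₁W (hSW W₁ i₁ (h hi₁))⟩,
    Finset.disjoint_left.2 fun i h₁ h₂ => hnot i (hSW W₂ i h₁) (hSW W₁ i h₂), fun i hi => ?_,
    hflat _, hflat _, hsup, hSW W₂, hSW W₁⟩
  exact (hor i hi).imp (fun h => (hS W₂ i).2 ⟨hi, h⟩) fun h => (hS W₁ i).2 ⟨hi, h⟩

/-! ### Induction over the flats -/

open Classical in
/-- The intersections with irreducible local arrangement defined by hyperplanes numbered in `T`. -/
def irreducibleIn (H : ι → Submodule ℂ V) (T : Finset ι) : Finset (Submodule ℂ V) :=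
  (irreducibleIntersections H).filter fun X => J H X ⊆ T

lemma mem_irreducibleIn {H : ι → Submodule ℂ V} {T : Finset ι} {X : Submodule ℂ V} :
    X ∈ irreducibleIn H T ↔ X ∈ irreducibleIntersections H ∧ J H X ⊆ T := by
  classical
  rw [irreducibleIn, Finset.mem_filter]

lemma irreducibleIn_mono (H : ι → Submodule ℂ V) {T₁ T₂ : Finset ι} (h : T₁ ⊆ T₂) :
    irreducibleIn H T₁ ⊆ irreducibleIn H T₂ := fun _ hX =>
  mem_irreducibleIn.2 ((mem_irreducibleIn.1 hX).imp id fun hJ => hJ.trans h)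

/-- The product of the factors `∑ s_i + r(X) + j` over `X` in `S` and `j < n`. -/
def factorProd (H : ι → Submodule ℂ V) (n : ℕ) (S : Finset (Submodule ℂ V)) : MvPolynomial ι ℂ :=
  ∏ X ∈ S, ∏ j ∈ Finset.range n, factor (J H X) X j

lemma factorProd_dvd (H : ι → Submodule ℂ V) {m n : ℕ} (hmn : m ≤ n)
    {S S' : Finset (Submodule ℂ V)} (hS : S ⊆ S') : factorProd H m S ∣ factorProd H n S' :=
  (Finset.prod_dvd_prod_of_dvd _ _ fun _ _ =>
    Finset.prod_dvd_prod_of_subset _ _ _ (Finset.range_mono hmn)).trans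
      (Finset.prod_dvd_prod_of_subset _ _ _ hS)

lemma InOrbit.of_dvd {l : ι → Module.Dual ℂ V} {T : Finset ι} {b c : MvPolynomial ι ℂ}
    (hb : InOrbit l T ⊤ (b • 1)) (h : b ∣ c) : InOrbit l T ⊤ (c • 1) := by
  obtain ⟨d, rfl⟩ := h
  rw [mul_comm, mul_smul]
  exact hb.smul d

lemma exists_inOrbit_factorProd [FiniteDimensional ℂ V] {l : ι → Module.Dual ℂ V}
    (hl : ∀ i, l i ≠ 0) (T : Finset ι) (hT : IsFlat (fun i => LinearMap.ker (l i)) T) :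
    ∃ n : ℕ, InOrbit l T ⊤
      (factorProd (fun i => LinearMap.ker (l i)) n
        (irreducibleIn (fun i => LinearMap.ker (l i)) T) • 1) := by
  classical
  induction T using Finset.strongInduction with
  | H T ih =>
  set H : ι → Submodule ℂ V := fun i => LinearMap.ker (l i) with hH
  rcases T.eq_empty_or_nonempty with rfl | hne
  · exact ⟨0, by simpa [factorProd] using InOrbit.base (l := l) (T := ∅) (W := ⊤)⟩
  have hJ := J_iInf hT
  by_cases hirr : IrreducibleArrangement (localArrangement H (⨅ i ∈ T, H i))
  · set Y := ⨅ i ∈ T, H i with hY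
    have hYmem : Y ∈ irreducibleIn H T := by
      refine mem_irreducibleIn.2 ⟨Finset.mem_filter.2 ⟨?_, hirr⟩, hJ.le⟩
      exact Finset.mem_image.2 ⟨T, Finset.mem_univ _, rfl⟩
    choose! n hn using ih
    -- A single bound for all proper flats, since `InOrbit.exists_of_proper_flats` needs the same
    -- `b` for each. The values of `n` at other subsets are arbitrary and harmless.
    set m := T.powerset.sup n with hm
    obtain ⟨K, hK⟩ := InOrbit.exists_of_proper_flats hT
      (b := factorProd H m ((irreducibleIn H T).erase Y)) <| by
        intro T' hT' hflat
        refine (hn T' hT' hflat).of_dvd (factorProd_dvd H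
          (Finset.le_sup (f := n) (Finset.mem_powerset.2 hT'.1)) fun X hX => ?_)
        refine Finset.mem_erase.2 ⟨?_, irreducibleIn_mono H hT'.1 hX⟩
        rintro rfl
        -- `Y` cannot come from a proper flat because `J(Y) = T`; its factors are thus still
        -- available for the Euler step.
        exact hT'.2 (hJ ▸ (mem_irreducibleIn.1 hX).2)
    refine ⟨max K m, hK.of_dvd ?_⟩
    rw [factorProd.eq_def H (max K m), ← Finset.mul_prod_erase _ _ hYmem, hJ]
    exact mul_dvd_mul
      (Finset.prod_dvd_prod_of_subset _ _ _ (Finset.range_mono (le_max_left K m)))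
      (factorProd_dvd H (le_max_right K m) subset_rfl)
  · obtain ⟨T₁, T₂, W₁, W₂, h₁, h₂, hdisj, hor, hf₁, hf₂, hW, hW₂, hW₁⟩ :=
      exists_splitting (fun i hi => hl i (LinearMap.ker_eq_top.1 hi)) hT hne hirr
    obtain ⟨n₁, hn₁⟩ := ih T₁ h₁ hf₁
    obtain ⟨n₂, hn₂⟩ := ih T₂ h₂ hf₂
    have hT₁₂ : T₁ ∪ T₂ = T :=
      (Finset.union_subset h₁.1 h₂.1).antisymm fun i hi => Finset.mem_union.2 (hor i hi)
    have hmul := InOrbit.mul_smul_one hdisj hW (fun i hi w hw => hW₂ i hi hw)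
      (fun i hi w hw => hW₁ i hi hw) hn₁ hn₂
    rw [hT₁₂] at hmul
    -- An irreducible arrangement is nonempty, so some index in `J(X)` would lie in both `T₁` and
    -- `T₂`. Disjointness keeps each factor from being used twice.
    have hdisj' : Disjoint (irreducibleIn H T₁) (irreducibleIn H T₂) := by
      rw [Finset.disjoint_left]
      intro X hX₁ hX₂
      obtain ⟨_, i, hi, -⟩ := (Finset.mem_filter.1 (mem_irreducibleIn.1 hX₁).1).2.1
      exact Finset.disjoint_left.1 hdisj ((mem_irreducibleIn.1 hX₁).2 hi)
        ((mem_irreducibleIn.1 hX₂).2 hi)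
    refine ⟨max n₁ n₂, hmul.of_dvd ((mul_dvd_mul
      (factorProd_dvd H (le_max_left n₁ n₂) subset_rfl)
      (factorProd_dvd H (le_max_right n₁ n₂) subset_rfl)).trans ?_)⟩
    rw [factorProd, factorProd, ← Finset.prod_union hdisj']
    exact factorProd_dvd H le_rfl
      (Finset.union_subset (irreducibleIn_mono H h₁.1) (irreducibleIn_mono H h₂.1))

end Flats

end HyperplaneArrangement

end

theorem mainTheorem4 {V : Type*} [AddCommGroup V] [Module ℂ V] [FiniteDimensional ℂ V]
    {ι : Type*} [Fintype ι]
    (H : ι → Submodule ℂ V) (hH : Function.Injective H)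
    (l : ι → Module.Dual ℂ V) (hl : ∀ i, l i ≠ 0) (hker : ∀ i, LinearMap.ker (l i) = H i) :
    ∃ N : ℕ,
      ∏ X ∈ HyperplaneArrangement.irreducibleIntersections H, ∏ j ∈ Finset.range (N + 1),
          (∑ i ∈ HyperplaneArrangement.J H X, MvPolynomial.X i +
            MvPolynomial.C ((HyperplaneArrangement.codim X : ℂ) + (j : ℂ))) ∈
        HyperplaneArrangement.bernsteinIdeal l := by
  classical
  open HyperplaneArrangement in
  obtain rfl : (fun i => LinearMap.ker (l i)) = H := funext hker
  obtain ⟨n, hn⟩ := exists_inOrbit_factorProd hl Finset.univ fun j _ => Finset.mem_univ j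
  -- The induction gives the factors with `j < n`, while the statement has `j ≤ N`; with `N = n` the
  -- surplus factor only multiplies a member of the ideal.
  exact ⟨n, action_of_inOrbit (hn.of_dvd (factorProd_dvd _ n.le_succ (Finset.filter_subset _ _)))⟩
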